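/- Let $K$ be an algebraically closed field of characteristic $0$, let $\mathfrak{s}$ be a finite-dimensional simple Lie algebra over $K$, and let $\mathfrak{t}\subset\mathfrak{s}$ be a Cartan subalgebra with root system $\Phi\subset\mathfrak{t}^*$. Assume that $\mathfrak{s}$ is simply laced, i.e. $\langle\alpha,\beta^\vee\rangle\in\{-1,0,1\}$ for all roots $\alpha\neq\pm\beta$. Let $\Lambda=\mathbb{Z}\Phi\subset\mathfrak{t}^*$ be the root lattice, with the symmetric positive-definite bilinear form $(\cdot,\cdot):\Lambda\times\Lambda\to\mathbb{Z}$ determined by $(\alpha,\beta)=\langle\beta,\alpha^\vee\rangle$ for all $\alpha,\beta\in\Phi$ (so $(\alpha,\alpha)=2$ for every root $\alpha$), and let $\mathrm{Aut}(\Lambda)$ be the group of $\mathbb{Z}$-linear bijections of $\Lambda$ preserving $(\cdot,\cdot)$. Let $w\in\mathrm{Aut}(\Lambda)$ be elliptic, i.e. such that the group of coinvariants $\Lambda/(1-w)\Lambda$ is finite. Then $w$ lifts to an automorphism of $\mathfrak{s}$ of the same order as $w$: there is a Lie algebra automorphism $\sigma$ of $\mathfrak{s}$ with $\sigma(\mathfrak{t})=\mathfrak{t}$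 and $(w\mu)(\sigma(x))=\mu(x)$ for all $\mu\in\Lambda$ and $x\in\mathfrak{t}$, such that the order of $\sigma$ equals the order of $w$. -/

import Mathlib

open Module

noncomputable section

namespace RootPairing

variable {ι K M N : Type*} [Field K] [CharZero K] [AddCommGroup M] [Module K M]
  [AddCommGroup N] [Module K N] (P : RootPairing ι K M N) [P.IsCrystallographic]

/-- A crystallographic root system is simply laced if `⟨α, β^∨⟩ ∈ {-1, 0, 1}` for all roots
`α ≠ ±β` (equivalently: its Dynkin diagram has no multiple edges). -/
def IsSimplyLaced : Prop :=
  ∀ i j : ι, P.root i ≠ P.root j → P.root i ≠ -P.root j →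
    P.pairingIn ℤ i j = -1 ∨ P.pairingIn ℤ i j = 0 ∨ P.pairingIn ℤ i j = 1

variable {P}

theorem IsSimplyLaced.pairingIn_comm [Finite ι] (h : P.IsSimplyLaced) (i j : ι) :
    P.pairingIn ℤ i j = P.pairingIn ℤ j i := by
  by_cases h1 : P.root i = P.root j
  · rw [P.root.injective h1]
  by_cases h2 : P.root i = -P.root j
  · have e : ∀ a b : ι, P.root a = -P.root b → P.pairing a b = -2 := by
      intro a b hab
      rw [← P.root_coroot'_eq_pairing, hab, map_neg, P.root_coroot'_eq_pairing, P.pairing_same]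
    have h3 : P.root j = -P.root i := by rw [h2, neg_neg]
    apply (algebraMap ℤ K).injective_int
    rw [P.algebraMap_pairingIn, P.algebraMap_pairingIn, e i j h2, e j i h3]
  · have h3 : P.root j ≠ -P.root i := fun h ↦ h2 (by rw [h, neg_neg])
    have hz := P.pairingIn_eq_zero_iff (S := ℤ) (i := i) (j := j)
    have hp := P.zero_lt_pairingIn_iff' (S := ℤ) (i := i) (j := j)
    rcases h i j h1 h2 with a | a | a <;> rcases h j i (Ne.symm h1) h3 with b | b | b <;>
      simp_all

variable (P)

/-- The map `ℤ^Φ → Λ` onto the root lattice `Λ = ℤΦ`, sending the basis vector of a root to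
that root. -/
def rootLatticeProj : (ι →₀ ℤ) →ₗ[ℤ] P.rootSpan ℤ :=
  Finsupp.linearCombination ℤ (P.rootSpanMem ℤ)

theorem rootLatticeProj_surjective : Function.Surjective P.rootLatticeProj := by
  rintro ⟨x, hx⟩
  obtain ⟨c, hc⟩ := (Finsupp.mem_span_range_iff_exists_finsupp).1 hx
  refine ⟨c, Subtype.ext ?_⟩
  change ((P.rootLatticeProj c : P.rootSpan ℤ) : M) = x
  rw [← hc, rootLatticeProj, Finsupp.linearCombination_apply, Finsupp.sum, Finsupp.sum]
  simp

/-- The map `ℤ^Φ → Hom(Λ, ℤ)` sending the basis vector of a root `α` to its coroot `α^∨`. -/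
def corootComb : (ι →₀ ℤ) →ₗ[ℤ] Dual ℤ (P.rootSpan ℤ) :=
  Finsupp.linearCombination ℤ (P.coroot'In ℤ)

variable {P}

theorem IsSimplyLaced.corootComb_apply_comm [Finite ι] (h : P.IsSimplyLaced) (c e : ι →₀ ℤ) :
    P.corootComb c (P.rootLatticeProj e) = P.corootComb e (P.rootLatticeProj c) := by
  suffices H : P.corootComb.compl₂ P.rootLatticeProj =
      (P.corootComb.compl₂ P.rootLatticeProj).flip from
    LinearMap.congr_fun₂ H c e
  ext i j
  simp [corootComb, rootLatticeProj, coroot'In_rootSpanMem_eq_pairingIn, h.pairingIn_comm i j]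

theorem IsSimplyLaced.ker_le [Finite ι] (h : P.IsSimplyLaced) :
    LinearMap.ker P.rootLatticeProj ≤ LinearMap.ker P.corootComb := by
  intro c hc
  rw [LinearMap.mem_ker] at hc ⊢
  ext x
  obtain ⟨e, rfl⟩ := P.rootLatticeProj_surjective x
  rw [h.corootComb_apply_comm, hc, map_zero, LinearMap.zero_apply]

/-- The bilinear form `(·, ·) : Λ × Λ → ℤ` on the root lattice `Λ = ℤΦ` of a simply laced root
system, normalized by `(α, α) = 2` for all roots `α`: it is the bilinear form with
`(α, β) = ⟨β, α^∨⟩` for all roots `α`, `β`. -/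
def rootLatticeForm [Finite ι] (h : P.IsSimplyLaced) : LinearMap.BilinForm ℤ (P.rootSpan ℤ) :=
  ((LinearMap.ker P.rootLatticeProj).liftQ P.corootComb h.ker_le) ∘ₗ
    (P.rootLatticeProj.quotKerEquivOfSurjective P.rootLatticeProj_surjective).symm.toLinearMap

theorem rootLatticeForm_root_root [Finite ι] (h : P.IsSimplyLaced) (i j : ι) :
    rootLatticeForm h (P.rootSpanMem ℤ i) (P.rootSpanMem ℤ j) = P.pairingIn ℤ i j := by
  have e : (P.rootLatticeProj.quotKerEquivOfSurjective P.rootLatticeProj_surjective).symm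
      (P.rootSpanMem ℤ i) = (LinearMap.ker P.rootLatticeProj).mkQ (Finsupp.single i 1) := by
    rw [LinearEquiv.symm_apply_eq, Submodule.mkQ_apply,
      LinearMap.quotKerEquivOfSurjective_apply_mk]
    simp [rootLatticeProj]
  rw [rootLatticeForm, LinearMap.comp_apply, LinearEquiv.coe_coe, e, Submodule.mkQ_apply,
    Submodule.liftQ_apply, h.pairingIn_comm]
  simp [corootComb, coroot'In_rootSpanMem_eq_pairingIn]

theorem rootLatticeForm_root_self [Finite ι] (h : P.IsSimplyLaced) (i : ι) :
    rootLatticeForm h (P.rootSpanMem ℤ i) (P.rootSpanMem ℤ i) = 2 := by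
  rw [rootLatticeForm_root_root, pairingIn_same]

/-- The group `Aut(Λ)` of lattice automorphisms of the root lattice: `ℤ`-linear bijections that
preserve the bilinear form. -/
def rootLatticeAut [Finite ι] (h : P.IsSimplyLaced) :
    Subgroup (P.rootSpan ℤ ≃ₗ[ℤ] P.rootSpan ℤ) where
  carrier := {w | ∀ x y, rootLatticeForm h (w x) (w y) = rootLatticeForm h x y}
  mul_mem' {v w} hv hw x y := by
    rw [LinearEquiv.mul_apply, LinearEquiv.mul_apply, hv, hw]
  one_mem' _ _ := rfl
  inv_mem' {w} hw x y := by
    have := hw (w⁻¹ x) (w⁻¹ y)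
    rw [← LinearEquiv.mul_apply, ← LinearEquiv.mul_apply, mul_inv_cancel] at this
    exact this.symm

end RootPairing

/-- An automorphism `w` of a lattice `Λ` is elliptic if the group of coinvariants
`Λ_w = Λ / (1 - w)Λ` is finite. -/
def IsEllipticAut {A : Type*} [AddCommGroup A] (w : A ≃ₗ[ℤ] A) : Prop :=
  Finite (A ⧸ LinearMap.range (LinearMap.id - w.toLinearMap))

namespace LieAlgebra

open LieAlgebra.IsKilling

variable {K L : Type*} [Field K] [CharZero K] [LieRing L] [LieAlgebra K L]
  [FiniteDimensional K L] [IsKilling K L] (H : LieSubalgebra K L) [H.IsCartanSubalgebra]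
  [LieModule.IsTriangularizable K H L]

/-- The root lattice `Λ ⊆ 𝔱*` of `L` relative to the Cartan subalgebra `H = 𝔱`: the `ℤ`-span of
the roots. -/
abbrev rootLattice : Submodule ℤ (Dual K H) := (rootSystem H).rootSpan ℤ

/-- The Lie algebra automorphism `σ` lifts the automorphism `w` of the root lattice: `σ` maps the
Cartan subalgebra `H` onto itself, and the induced action `μ ↦ μ ∘ (σ|_H)⁻¹` on `H*` restricts to
`w` on the root lattice, i.e. `(w μ) (σ x) = μ x` for all `μ ∈ Λ` and `x ∈ H`
(so that `σ` maps the root space of a root `α` onto that of `w α`). -/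
def IsLiftOf (σ : L ≃ₗ⁅K⁆ L) (w : rootLattice H ≃ₗ[ℤ] rootLattice H) : Prop :=
  H.map (σ : L →ₗ⁅K⁆ L) = H ∧
    ∀ (μ : rootLattice H) (x y : H), (y : L) = σ x →
      (w μ : Dual K H) y = (μ : Dual K H) x

end LieAlgebra

end

/-!
Let `S` be the form on the root lattice and choose a bilinear form `B` with `B + Bᵀ = S`. There are
root vectors `e x` with `⁅e x, e y⁆ = (-1) ^ B x y • e (x + y)` whenever `x`, `y` and `x + y` are
roots: for positive roots they are constructed by induction on the height, and the Jacobi identity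
fixes the remaining signs.

Since `w` preserves `S`, the form `B (w x) (w y) - B x y` is alternating, hence of the shape
`C x y - C y x` for a bilinear form `C`. Consequently `e x ↦ (-1) ^ C x x • e (w x)` defines an
automorphism `σ` lifting `w`. If `w ^ n = 1`, then `σ ^ n` multiplies `e x` by the sign with
exponent `∑ i < n, C (w ^ i x) (w ^ i x)`, which modulo two is determined by the orbit sum
`s = ∑ i < n, w ^ i x` up to boundary terms that vanish with `s`: telescoping
`C (w ^ i x) (w ^ j x) - C (w ^ j x) (w ^ i x)` over `i < j` gives `C s s` plus such terms. An
elliptic `w` has no nonzero invariant vector, so `s = 0` and `σ ^ n = 1`.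
-/

noncomputable section

open LieAlgebra LieAlgebra.IsKilling LieModule RootPairing

section Signs

variable {K : Type*} [DivisionRing K]

theorem neg_one_zpow_add (m n : ℤ) : (-1 : K) ^ (m + n) = (-1) ^ m * (-1) ^ n :=
  zpow_add₀ (neg_ne_zero.2 one_ne_zero) m n

theorem neg_one_zpow_eq_of_modEq {m n : ℤ} (h : m ≡ n [ZMOD 2]) : (-1 : K) ^ m = (-1) ^ n := by
  simp only [neg_one_zpow_eq_ite, Int.even_iff, h.eq]

theorem neg_one_zpow_mul_self (n : ℤ) : (-1 : K) ^ n * (-1) ^ n = 1 := by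
  rw [← neg_one_zpow_add, (Even.add_self n).neg_one_zpow]

end Signs

section BilinearForms

variable {Λ : Type*} [AddCommGroup Λ]

theorem exists_add_flip_eq_of_even [Module.Free ℤ Λ] {S : LinearMap.BilinForm ℤ Λ}
    (hS : ∀ x y, S x y = S y x) (heven : ∀ x, Even (S x x)) :
    ∃ B : LinearMap.BilinForm ℤ Λ, ∀ x y, B x y + B y x = S x y := by
  classical
  let b := Module.Free.chooseBasis ℤ Λ
  let _ : LinearOrder (Module.Free.ChooseBasisIndex ℤ Λ) := linearOrderOfSTO WellOrderingRel
  let B : LinearMap.BilinForm ℤ Λ := b.constr ℤ fun i ↦ b.constr ℤ fun j ↦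
    if i < j then S (b i) (b j) else if i = j then S (b i) (b i) / 2 else 0
  have hB : B + B.flip = S := by
    refine b.ext fun i ↦ b.ext fun j ↦ ?_
    rcases lt_trichotomy i j with h | rfl | h
    · simp [B, Basis.constr_basis, h, h.not_gt, h.ne']
    · obtain ⟨k, hk⟩ := heven (b i)
      simp only [B, LinearMap.add_apply, LinearMap.BilinForm.flip_apply, Basis.constr_basis,
        lt_irrefl, if_true, if_false, hk]
      omega
    · simp [B, Basis.constr_basis, h, h.not_gt, h.ne', hS (b i) (b j)]
  exact ⟨B, fun x y ↦ by rw [← hB]; rfl⟩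

theorem exists_sub_flip_eq_of_alternating [Module.Free ℤ Λ] {D : LinearMap.BilinForm ℤ Λ}
    (hD : D.IsAlt) : ∃ C : LinearMap.BilinForm ℤ Λ, ∀ x y, C x y - C y x = D x y := by
  classical
  let b := Module.Free.chooseBasis ℤ Λ
  let _ : LinearOrder (Module.Free.ChooseBasisIndex ℤ Λ) := linearOrderOfSTO WellOrderingRel
  let C : LinearMap.BilinForm ℤ Λ := b.constr ℤ fun i ↦ b.constr ℤ fun j ↦
    if i < j then D (b i) (b j) else 0
  have hC : C - C.flip = D := by
    refine b.ext fun i ↦ b.ext fun j ↦ ?_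
    rcases lt_trichotomy i j with h | rfl | h
    · simp [C, Basis.constr_basis, h, h.not_gt]
    · simp [C, Basis.constr_basis, hD.self_eq_zero]
    · simp [C, Basis.constr_basis, h, h.not_gt, ← LinearMap.IsAlt.neg hD (b i) (b j)]
  exact ⟨C, fun x y ↦ by rw [← hC]; rfl⟩

end BilinearForms

section Orbits

variable {Λ : Type*} [AddCommGroup Λ]

/-- The partial sum `x + w x + ⋯ + w ^ (n - 1) x` of the orbit of `x` under `w`. -/
def orbitSum (w : Λ ≃ₗ[ℤ] Λ) (n : ℕ) (x : Λ) : Λ :=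
  ∑ i ∈ Finset.range n, (w ^ i) x

variable (w : Λ ≃ₗ[ℤ] Λ)

theorem orbitSum_succ (n : ℕ) (x : Λ) : orbitSum w (n + 1) x = orbitSum w n x + (w ^ n) x :=
  Finset.sum_range_succ _ n

theorem orbitSum_succ' (n : ℕ) (x : Λ) : orbitSum w (n + 1) x = x + w (orbitSum w n x) := by
  simp [orbitSum, Finset.sum_range_succ', pow_succ', add_comm]

theorem orbitSum_sub_apply (n : ℕ) (x : Λ) : orbitSum w n (x - w x) = x - (w ^ n) x := by
  simpa [orbitSum, pow_succ] using Finset.sum_range_sub' (fun i ↦ (w ^ i) x) n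

variable {w}

theorem IsEllipticAut.orbitSum_eq_zero [IsAddTorsionFree Λ] (h : IsEllipticAut w) {n : ℕ}
    (hn : w ^ n = 1) (x : Λ) : orbitSum w n x = 0 := by
  have : Finite (Λ ⧸ LinearMap.range (LinearMap.id - w.toLinearMap)) := h
  obtain ⟨m, hm, hmx⟩ := (isOfFinAddOrder_of_finite (Submodule.Quotient.mk
    (p := LinearMap.range (LinearMap.id - w.toLinearMap)) x)).exists_nsmul_eq_zero
  rw [← Submodule.Quotient.mk_smul, Submodule.Quotient.mk_eq_zero] at hmx
  obtain ⟨z, hz : z - w z = m • x⟩ := hmx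
  have hsum : m • orbitSum w n x = 0 := by
    calc m • orbitSum w n x = orbitSum w n (m • x) := by simp [orbitSum, Finset.smul_sum]
      _ = 0 := by simp [← hz, orbitSum_sub_apply, hn]
  exact (nsmul_eq_zero_iff_right hm.ne').1 hsum

theorem apply_orbitSum_self_modEq {B C : LinearMap.BilinForm ℤ Λ}
    (hC : ∀ x y, C x y - C y x = B (w x) (w y) - B x y) (x : Λ) (n : ℕ) :
    C (orbitSum w n x) (orbitSum w n x) ≡
      ∑ i ∈ Finset.range n, C ((w ^ i) x) ((w ^ i) x) +
        (B (orbitSum w n x) ((w ^ n) x) - B x (w (orbitSum w n x))) [ZMOD 2] := by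
  induction n with
  | zero => simp [orbitSum]
  | succ n ih =>
    have boundary : B (orbitSum w (n + 1) x) ((w ^ (n + 1)) x) -
          B x (w (orbitSum w (n + 1) x)) =
        B (w (orbitSum w n x)) (w ((w ^ n) x)) - B x (w (orbitSum w n x)) := by
      nth_rw 1 [orbitSum_succ']
      rw [orbitSum_succ, pow_succ', LinearEquiv.mul_apply]
      simp only [map_add, LinearMap.add_apply]
      ring
    have hcross := hC (orbitSum w n x) ((w ^ n) x)
    rw [boundary, orbitSum_succ, Finset.sum_range_succ]
    simp only [map_add, LinearMap.add_apply]
    rw [Int.modEq_iff_dvd] at ih ⊢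
    obtain ⟨k, hk⟩ := ih
    exact ⟨k - C ((w ^ n) x) (orbitSum w n x), by linarith⟩

theorem even_sum_orbit_of_isEllipticAut [IsAddTorsionFree Λ] (hell : IsEllipticAut w) {n : ℕ}
    (hn : w ^ n = 1) {B C : LinearMap.BilinForm ℤ Λ}
    (hC : ∀ x y, C x y - C y x = B (w x) (w y) - B x y) (x : Λ) :
    Even (∑ i ∈ Finset.range n, C ((w ^ i) x) ((w ^ i) x)) := by
  have h := apply_orbitSum_self_modEq hC x n
  simp only [hell.orbitSum_eq_zero hn, map_zero, LinearMap.zero_apply, sub_zero, add_zero] at h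
  exact Int.even_iff.2 h.symm

end Orbits

/-- The standard form of a simply laced root lattice: a positive definite symmetric form on a
lattice generated by its vectors of norm two. The roots are encoded as the vectors `x` with
`S x x = 2`. -/
structure IsRootLatticeForm {Λ : Type*} [AddCommGroup Λ] (S : LinearMap.BilinForm ℤ Λ) : Prop where
  comm : ∀ x y, S x y = S y x
  pos : ∀ x, x ≠ 0 → 0 < S x x
  span_eq_top : Submodule.span ℤ {x | S x x = 2} = ⊤

theorem form_add_self {Λ : Type*} [AddCommGroup Λ] {S : LinearMap.BilinForm ℤ Λ}
    (hS : ∀ x y, S x y = S y x) (x y : Λ) :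
    S (x + y) (x + y) = S x x + 2 * S x y + S y y := by
  simp only [map_add, LinearMap.add_apply, hS y x]
  ring

namespace IsRootLatticeForm

variable {Λ : Type*} [AddCommGroup Λ] {S : LinearMap.BilinForm ℤ Λ} (hS : IsRootLatticeForm S)
  {x y : Λ}

include hS

theorem even_self (x : Λ) : Even (S x x) := by
  have hx : x ∈ Submodule.span ℤ {x | S x x = 2} := hS.span_eq_top ▸ Submodule.mem_top
  induction hx using Submodule.span_induction with
  | mem x hx => exact hx.symm ▸ even_two
  | zero => simp
  | add x y _ _ hx hy =>
    rw [form_add_self hS.comm]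
    exact (hx.add (even_two_mul _)).add hy
  | smul n x _ hx => simpa using (hx.mul_left n).mul_left n

theorem eq_of_form_eq_two (hx : S x x = 2) (hy : S y y = 2) (h : S x y = 2) : x = y := by
  by_contra hne
  have hpos := hS.pos (x + -y) (by rwa [← sub_eq_add_neg, sub_ne_zero])
  rw [form_add_self hS.comm] at hpos
  simp only [map_neg, LinearMap.neg_apply, hx, hy, h] at hpos
  omega

theorem neg_one_le_form (hx : S x x = 2) (hy : S y y = 2) (h : x + y ≠ 0) : -1 ≤ S x y := by
  have := hS.pos _ h
  rw [form_add_self hS.comm, hx, hy] at this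
  omega

theorem eq_neg_or_form_eq_neg_one_or_nonneg (hx : S x x = 2) (hy : S y y = 2) :
    y = -x ∨ S x y = -1 ∨ 0 ≤ S x y := by
  by_cases h : x + y = 0
  · exact Or.inl (eq_neg_of_add_eq_zero_right h)
  · have := hS.neg_one_le_form hx hy h
    omega

theorem sub_self_eq_two (hx : S x x = 2) (hy : S y y = 2) (h : S x y = 1) :
    S (x - y) (x - y) = 2 := by
  rw [sub_eq_add_neg, form_add_self hS.comm]
  simp [hx, hy, h]

theorem add_self_eq_two (hx : S x x = 2) (hy : S y y = 2) (h : S x y = -1) :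
    S (x + y) (x + y) = 2 := by
  rw [form_add_self hS.comm, hx, hy, h]
  norm_num

end IsRootLatticeForm

/-- Three roots `x`, `y`, `z` with sum zero. -/
structure IsRootTriple {Λ : Type*} [AddCommGroup Λ] (S : LinearMap.BilinForm ℤ Λ)
    (x y z : Λ) : Prop where
  left : S x x = 2
  right : S y y = 2
  form_eq : S x y = -1
  add_eq : x + y = -z

namespace IsRootTriple

variable {Λ : Type*} [AddCommGroup Λ] {S : LinearMap.BilinForm ℤ Λ} {x y z : Λ}

theorem third (hS : IsRootLatticeForm S) (h : IsRootTriple S x y z) : S z z = 2 := by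
  have := hS.add_self_eq_two h.left h.right h.form_eq
  rwa [h.add_eq, map_neg, map_neg, LinearMap.neg_apply, neg_neg] at this

theorem rotate (hS : IsRootLatticeForm S) (h : IsRootTriple S x y z) : IsRootTriple S y z x where
  left := h.right
  right := h.third hS
  form_eq := by
    rw [eq_neg_of_add_eq_zero_right (eq_neg_iff_add_eq_zero.1 h.add_eq), map_neg, map_add,
      h.right, hS.comm, h.form_eq]
    norm_num
  add_eq := by rw [← neg_eq_iff_eq_neg.2 h.add_eq]; abel

theorem swap (hS : IsRootLatticeForm S) (h : IsRootTriple S x y z) : IsRootTriple S y x z :=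
  ⟨h.right, h.left, hS.comm y x ▸ h.form_eq, add_comm x y ▸ h.add_eq⟩

theorem neg (h : IsRootTriple S x y z) : IsRootTriple S (-x) (-y) (-z) :=
  ⟨by simp [h.left], by simp [h.right], by simp [h.form_eq], by rw [← neg_add, h.add_eq]⟩

theorem apply_rotate {B : LinearMap.BilinForm ℤ Λ} (hB : ∀ x y, B x y + B y x = S x y)
    (h : IsRootTriple S x y z) : B y z = B x y := by
  rw [← neg_eq_iff_eq_neg.2 h.add_eq, map_neg, map_add]
  linarith [hB x y, hB y y, h.form_eq, h.right]

theorem of_rotate {p : Λ → Λ → Λ → Prop} (hS : IsRootLatticeForm S) {ht : Λ →ₗ[ℤ] ℤ}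
    (hht : ∀ x, S x x = 2 → ht x ≠ 0)
    (rotate : ∀ {x y z}, IsRootTriple S x y z → p x y z → p y z x)
    (pos : ∀ {x y z}, IsRootTriple S x y z → 0 < ht x → 0 < ht y → p x y z)
    (neg : ∀ {x y z}, IsRootTriple S x y z → ht x < 0 → ht y < 0 → p x y z)
    (h : IsRootTriple S x y z) : p x y z := by
  have h' := h.rotate hS
  have h'' := h'.rotate hS
  have of_yz : p y z x → p x y z := fun hp ↦ rotate h'' (rotate h' hp)
  have of_zx : p z x y → p x y z := rotate h''
  rcases (hht x h.left).lt_or_gt with hx | hx <;>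
    rcases (hht y h'.left).lt_or_gt with hy | hy <;>
    rcases (hht z h''.left).lt_or_gt with hz | hz <;>
    first
    | exact pos h hx hy
    | exact neg h hx hy
    | exact of_yz (pos h' hy hz)
    | exact of_yz (neg h' hy hz)
    | exact of_zx (pos h'' hz hx)
    | exact of_zx (neg h'' hz hx)

end IsRootTriple

/-- A grading of the Lie algebra `L` by a root lattice with the shape of the root space
decomposition of a simply laced Lie algebra. -/
structure SimplyLacedGrading (K L : Type*) {Λ : Type*} [Field K] [LieRing L] [LieAlgebra K L]
    [AddCommGroup Λ] (S : LinearMap.BilinForm ℤ Λ) extends IsRootLatticeForm S where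
  /-- The homogeneous parts. -/
  part : Λ → Submodule K L
  iSupIndep_part : iSupIndep part
  iSup_part : ⨆ x, part x = ⊤
  lie_mem : ∀ {x y u v}, u ∈ part x → v ∈ part y → ⁅u, v⁆ ∈ part (x + y)
  /-- The additive extension to the lattice of the passage from roots to coroots. -/
  coroot : Λ →+ L
  part_zero : part 0 = Submodule.span K (Set.range coroot)
  coroot_lie : ∀ x {y v}, v ∈ part y → ⁅coroot x, v⁆ = (S x y : K) • v
  part_eq_bot : ∀ {x}, x ≠ 0 → S x x ≠ 2 → part x = ⊥
  finrank_part : ∀ {x}, S x x = 2 → finrank K (part x) = 1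
  exists_lie_eq_coroot : ∀ {x}, S x x = 2 → ∃ u ∈ part x, ∃ v ∈ part (-x), ⁅u, v⁆ = coroot x
  center_eq_bot : LieAlgebra.center K L = ⊥

namespace SimplyLacedGrading

variable {K L Λ : Type*} [Field K] [LieRing L] [LieAlgebra K L] [AddCommGroup Λ]
  {S : LinearMap.BilinForm ℤ Λ} (G : SimplyLacedGrading K L S) {x y : Λ} {u v : L}

theorem exists_eq_smul (hx : S x x = 2) (hu : u ∈ G.part x) (hu0 : u ≠ 0) (hv : v ∈ G.part x) :
    ∃ c : K, v = c • u := by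
  obtain ⟨c, hc⟩ := (finrank_eq_one_iff_of_nonzero' (⟨u, hu⟩ : G.part x)
    fun h ↦ hu0 (congrArg Subtype.val h)).1 (G.finrank_part hx) ⟨v, hv⟩
  exact ⟨c, congrArg Subtype.val hc.symm⟩

theorem part_eq_bot_of_two_lt (h : 2 < S x x) : G.part x = ⊥ :=
  G.part_eq_bot (by rintro rfl; simp at h) h.ne'

theorem lie_eq_zero (hx : S x x = 2) (hy : S y y = 2) (h : 0 ≤ S x y) (hu : u ∈ G.part x)
    (hv : v ∈ G.part y) : ⁅u, v⁆ = 0 := by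
  have := G.lie_mem hu hv
  rwa [G.part_eq_bot_of_two_lt (by rw [form_add_self G.comm]; omega), Submodule.mem_bot] at this

theorem coroot_mem (x : Λ) : G.coroot x ∈ G.part 0 := by
  rw [G.part_zero]
  exact Submodule.subset_span ⟨x, rfl⟩

theorem coroot_lie_coroot (x y : Λ) : ⁅G.coroot x, G.coroot y⁆ = 0 := by
  simpa using G.coroot_lie x (G.coroot_mem y)

theorem exists_mem_part_ne_zero (hx : S x x = 2) : ∃ u ∈ G.part x, u ≠ 0 := by
  obtain ⟨⟨u, hu⟩, hu0, -⟩ := finrank_eq_one_iff'.1 (G.finrank_part hx)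
  exact ⟨u, hu, fun h ↦ hu0 (Subtype.ext h)⟩

theorem coroot_ne_zero [CharZero K] (hx : S x x = 2) : G.coroot x ≠ 0 := by
  intro h
  obtain ⟨u, hu, hu0⟩ := G.exists_mem_part_ne_zero hx
  have hlie := G.coroot_lie x hu
  rw [h, zero_lie, hx, eq_comm, smul_eq_zero] at hlie
  exact hu0 (hlie.resolve_left (by norm_num))

theorem exists_lie_eq_coroot_of_mem (hx : S x x = 2) (hu : u ∈ G.part x) (hu0 : u ≠ 0) :
    ∃ v ∈ G.part (-x), ⁅u, v⁆ = G.coroot x := by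
  obtain ⟨u', hu', v, hv, h⟩ := G.exists_lie_eq_coroot hx
  obtain ⟨c, rfl⟩ := G.exists_eq_smul hx hu hu0 hu'
  exact ⟨c • v, Submodule.smul_mem _ _ hv, by rw [← h, lie_smul, smul_lie]⟩

theorem lie_ne_zero (hx : S x x = 2) (hy : S y y = 2) (h : S x y = -1) (hu : u ∈ G.part x)
    (hu0 : u ≠ 0) (hv : v ∈ G.part y) (hv0 : v ≠ 0) : ⁅u, v⁆ ≠ 0 := by
  intro huv
  obtain ⟨u', hu', huu'⟩ := G.exists_lie_eq_coroot_of_mem hx hu hu0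
  have hu'v : ⁅u', v⁆ = 0 := G.lie_eq_zero (by simpa using hx) hy (by simp [h]) hu' hv
  have hJacobi := lie_lie u u' v
  rw [huv, hu'v, huu', G.coroot_lie x hv, h] at hJacobi
  simp [hv0] at hJacobi

section PositiveRoots

variable (ht : Λ →ₗ[ℤ] ℤ) (B : LinearMap.BilinForm ℤ Λ)

variable (S) in
/-- `z = x + y` is a decomposition of a root into roots that are positive with respect to the
height functional `ht`. -/
structure IsPosDecomp (z x y : Λ) : Prop where
  left : S x x = 2
  right : S y y = 2
  left_pos : 0 < ht x
  right_pos : 0 < ht y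
  form_eq : S x y = -1
  add_eq : x + y = z

variable (K) in
/-- The root vector for `x + y` prescribed by those for `x` and `y` when the structure constants
are the signs `(-1) ^ B x y`. -/
def prescribedVec (e : Λ → L) (x y : Λ) : L := (-1 : K) ^ B x y • ⁅e x, e y⁆

/-- Root vectors for the positive roots of height at most `n` with structure constants
`(-1) ^ B x y`. -/
structure IsPosSystemUpTo (n : ℤ) (e : Λ → L) : Prop where
  mem : ∀ {z}, S z z = 2 → 0 < ht z → ht z ≤ n → e z ∈ G.part z
  ne_zero : ∀ {z}, S z z = 2 → 0 < ht z → ht z ≤ n → e z ≠ 0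
  prescribedVec_eq : ∀ {z x y}, IsPosDecomp S ht z x y → ht z ≤ n →
    prescribedVec K B e x y = e z

variable {ht B} {e : Λ → L} {n : ℤ}

theorem IsPosDecomp.symm (hS : IsRootLatticeForm S) {z : Λ} (h : IsPosDecomp S ht z x y) :
    IsPosDecomp S ht z y x :=
  ⟨h.right, h.left, h.right_pos, h.left_pos, hS.comm y x ▸ h.form_eq, add_comm x y ▸ h.add_eq⟩

theorem IsPosDecomp.ht_eq {z : Λ} (h : IsPosDecomp S ht z x y) : ht z = ht x + ht y := by
  rw [← h.add_eq, map_add]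

theorem IsPosDecomp.right_eq {z y' : Λ} (h : IsPosDecomp S ht z x y)
    (h' : IsPosDecomp S ht z x y') : y = y' :=
  add_left_cancel (h.add_eq.trans h'.add_eq.symm)

theorem lie_eq_of_prescribedVec_eq {z : Λ} (h : prescribedVec K B e x y = e z) :
    ⁅e x, e y⁆ = (-1 : K) ^ B x y • e z := by
  rw [← h, prescribedVec, smul_smul, neg_one_zpow_mul_self, one_smul]

theorem neg_one_zpow_flip (hB : ∀ x y, B x y + B y x = S x y) (h : S x y = -1) :
    (-1 : K) ^ B y x = -(-1) ^ B x y := by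
  have hmod : B y x ≡ B x y + 1 [ZMOD 2] :=
    Int.modEq_iff_dvd.2 ⟨B x y + 1, by linarith [hB x y]⟩
  rw [neg_one_zpow_eq_of_modEq hmod, neg_one_zpow_add, zpow_one, mul_neg_one]

theorem prescribedVec_comm (hB : ∀ x y, B x y + B y x = S x y) (h : S x y = -1) :
    prescribedVec K B e x y = prescribedVec K B e y x := by
  rw [prescribedVec, prescribedVec, neg_one_zpow_flip hB h, ← lie_skew, neg_smul, smul_neg]

variable {G}

theorem IsPosSystemUpTo.prescribedVec_assoc (he : G.IsPosSystemUpTo ht B n e) {a d b : Λ}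
    (had : IsPosDecomp S ht (a + d) a d) (hdb : IsPosDecomp S ht (d + b) d b)
    (hn : ht a + ht d + ht b ≤ n + 1) (hab : S a b = 0) :
    prescribedVec K B e (a + d) b = prescribedVec K B e a (d + b) := by
  have ha0 := had.left_pos
  have hb0 := hdb.right_pos
  have lie_ad := lie_eq_of_prescribedVec_eq (he.prescribedVec_eq had (by rw [map_add]; omega))
  have lie_db := lie_eq_of_prescribedVec_eq (he.prescribedVec_eq hdb (by rw [map_add]; omega))
  have hd0 := had.right_pos
  have lie_ab : ⁅e a, e b⁆ = 0 := G.lie_eq_zero had.left hdb.right hab.ge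
    (he.mem had.left ha0 (by omega)) (he.mem hdb.right hb0 (by omega))
  have hJacobi := lie_lie (e a) (e d) (e b)
  rw [lie_ab, lie_zero, sub_zero, lie_ad, lie_db, smul_lie, lie_smul] at hJacobi
  simp only [prescribedVec, map_add, LinearMap.add_apply, neg_one_zpow_add]
  calc ((-1 : K) ^ B a b * (-1) ^ B d b) • ⁅e (a + d), e b⁆
      = ((-1 : K) ^ B a b * (-1) ^ B d b * (-1) ^ B a d) •
          (-1 : K) ^ B a d • ⁅e (a + d), e b⁆ := by
        rw [smul_smul, mul_assoc _ ((-1 : K) ^ B a d), neg_one_zpow_mul_self, mul_one]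
    _ = ((-1 : K) ^ B a b * (-1) ^ B d b * (-1) ^ B a d * (-1 : K) ^ B d b) •
          ⁅e a, e (d + b)⁆ := by rw [hJacobi, smul_smul]
    _ = ((-1 : K) ^ B a d * (-1) ^ B a b) • ⁅e a, e (d + b)⁆ := by
        congr 1
        linear_combination
          ((-1 : K) ^ B a b * (-1) ^ B a d) * neg_one_zpow_mul_self (K := K) (B d b)

theorem IsPosSystemUpTo.prescribedVec_eq_of_form_eq_one (hht : ∀ x, S x x = 2 → ht x ≠ 0)
    (he : G.IsPosSystemUpTo ht B n e) {z a b : Λ} (hn : ht z ≤ n + 1)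
    (hxy : IsPosDecomp S ht z x y) (hab : IsPosDecomp S ht z a b) (hxa : S x a = 1) :
    prescribedVec K B e x y = prescribedVec K B e a b := by
  wlog hd0 : 0 < ht (x - a) generalizing x y a b
  · refine (this hab hxy (by rw [G.comm, hxa]) ?_).symm
    have hne := hht (x - a) (G.sub_self_eq_two hxy.left hab.left hxa)
    rw [map_sub] at hd0 hne ⊢
    omega
  obtain ⟨d, rfl⟩ : ∃ d, x = a + d := ⟨x - a, (add_sub_cancel a x).symm⟩
  rw [add_sub_cancel_left] at hd0
  obtain rfl : b = d + y := by
    rw [← add_right_inj a, hab.add_eq, ← hxy.add_eq, add_assoc]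
  have hd := G.sub_self_eq_two hxy.left hab.left hxa
  rw [add_sub_cancel_left] at hd
  have haa := hab.left
  have hyy := hxy.right
  have hx := hxy.form_eq
  have hxx := hxy.left
  have ha := hab.form_eq
  have hb := hab.right
  rw [form_add_self G.comm] at hxx hb
  rw [map_add, LinearMap.add_apply] at hx
  rw [map_add] at ha
  exact he.prescribedVec_assoc ⟨haa, hd, hab.left_pos, hd0, by omega, rfl⟩
    ⟨hd, hyy, hd0, hxy.right_pos, by omega, rfl⟩
    (by rwa [← map_add, ← map_add, hxy.add_eq]) (by omega)

/-- Two decompositions `z = x + y = a + b` satisfy `S x a + S x b = S x z = 1`, so up to exchanging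
`a` and `b` either `x = a` or `S x a = 1`. -/
theorem IsPosSystemUpTo.prescribedVec_unique (hB : ∀ x y, B x y + B y x = S x y)
    (hht : ∀ x, S x x = 2 → ht x ≠ 0) (he : G.IsPosSystemUpTo ht B n e) {z a b : Λ}
    (hn : ht z ≤ n + 1) (hxy : IsPosDecomp S ht z x y) (hab : IsPosDecomp S ht z a b) :
    prescribedVec K B e x y = prescribedVec K B e a b := by
  have hsum : S x a + S x b = 1 := by
    rw [← map_add, hab.add_eq, ← hxy.add_eq, map_add, hxy.left, hxy.form_eq]
    norm_num
  have h_ge : ∀ {c}, S c c = 2 → 0 < ht c → -1 ≤ S x c := fun hc hc0 ↦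
    G.neg_one_le_form hxy.left hc fun h ↦ by
      have := congrArg ht h
      have := hxy.left_pos
      rw [map_add, map_zero] at *
      omega
  wlog h : 1 ≤ S x a generalizing a b
  · rw [prescribedVec_comm hB hab.form_eq]
    exact this (hab.symm G.toIsRootLatticeForm) (by rwa [add_comm]) (by omega)
  have := h_ge hab.right hab.right_pos
  obtain h | h : S x a = 1 ∨ S x a = 2 := by omega
  · exact he.prescribedVec_eq_of_form_eq_one hht hn hxy hab h
  · obtain rfl := G.eq_of_form_eq_two hxy.left hab.left h
    rw [hxy.right_eq hab]

variable (G ht B) in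
open Classical in
/-- Root vectors for the positive roots: arbitrary ones for the indecomposable roots, and otherwise
prescribed recursively by an arbitrary decomposition. -/
def posRootVec (z : Λ) : L :=
  if h : ∃ p : Λ × Λ, IsPosDecomp S ht z p.1 p.2 then
    (-1 : K) ^ B h.choose.1 h.choose.2 • ⁅posRootVec h.choose.1, posRootVec h.choose.2⁆
  else if hz : S z z = 2 then (G.exists_mem_part_ne_zero hz).choose else 0
termination_by (ht z).toNat
decreasing_by
  all_goals
    have := h.choose_spec.ht_eq
    have := h.choose_spec.left_pos
    have := h.choose_spec.right_pos
    omega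

theorem exists_posRootVec_eq_prescribedVec {z : Λ} (h : IsPosDecomp S ht z x y) :
    ∃ a b, IsPosDecomp S ht z a b ∧
      G.posRootVec ht B z = prescribedVec K B (G.posRootVec ht B) a b := by
  have h' : ∃ p : Λ × Λ, IsPosDecomp S ht z p.1 p.2 := ⟨(x, y), h⟩
  exact ⟨h'.choose.1, h'.choose.2, h'.choose_spec, by rw [posRootVec, dif_pos h']; rfl⟩

theorem posRootVec_mem_and_ne_zero_of_indecomposable {z : Λ} (hz : S z z = 2)
    (h : ∀ x y, ¬ IsPosDecomp S ht z x y) :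
    G.posRootVec ht B z ∈ G.part z ∧ G.posRootVec ht B z ≠ 0 := by
  rw [posRootVec, dif_neg (by rintro ⟨p, hp⟩; exact h _ _ hp), dif_pos hz]
  exact (G.exists_mem_part_ne_zero hz).choose_spec

theorem IsPosSystemUpTo.posRootVec_mem_and_ne_zero
    (ih : G.IsPosSystemUpTo ht B n (G.posRootVec ht B)) {z : Λ} (hz : S z z = 2)
    (hn : ht z ≤ n + 1) : G.posRootVec ht B z ∈ G.part z ∧ G.posRootVec ht B z ≠ 0 := by
  by_cases h : ∃ x y, IsPosDecomp S ht z x y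
  · obtain ⟨x, y, h⟩ := h
    obtain ⟨a, b, hab, h_eq⟩ := exists_posRootVec_eq_prescribedVec (G := G) (B := B) h
    have hht := hab.ht_eq
    have ha0 := hab.left_pos
    have hb0 := hab.right_pos
    have ha := ih.mem hab.left ha0 (by omega)
    have hb := ih.mem hab.right hb0 (by omega)
    rw [h_eq, prescribedVec]
    refine ⟨Submodule.smul_mem _ _ (hab.add_eq ▸ G.lie_mem ha hb), smul_ne_zero
      (zpow_ne_zero _ (neg_ne_zero.2 one_ne_zero)) (G.lie_ne_zero hab.left hab.right hab.form_eq
        ha (ih.ne_zero hab.left ha0 (by omega)) hb (ih.ne_zero hab.right hb0 (by omega)))⟩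
  · exact posRootVec_mem_and_ne_zero_of_indecomposable hz fun x y hxy ↦ h ⟨x, y, hxy⟩

theorem isPosSystemUpTo_posRootVec (hB : ∀ x y, B x y + B y x = S x y)
    (hht : ∀ x, S x x = 2 → ht x ≠ 0) (n : ℕ) :
    G.IsPosSystemUpTo ht B n (G.posRootVec ht B) := by
  induction n with
  | zero =>
    refine ⟨fun _ h h' ↦ by omega, fun _ h h' ↦ by omega, fun h h' ↦ ?_⟩
    have := h.ht_eq
    have := h.left_pos
    have := h.right_pos
    omega
  | succ n ih =>
    push_cast
    refine ⟨fun hz _ hn ↦ (ih.posRootVec_mem_and_ne_zero hz hn).1,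
      fun hz _ hn ↦ (ih.posRootVec_mem_and_ne_zero hz hn).2, fun h hn ↦ ?_⟩
    obtain ⟨a, b, hab, h_eq⟩ := exists_posRootVec_eq_prescribedVec (G := G) (B := B) h
    rw [h_eq, ih.prescribedVec_unique hB hht hn h hab]

theorem posRootVec_mem (hB : ∀ x y, B x y + B y x = S x y) (hht : ∀ x, S x x = 2 → ht x ≠ 0)
    (hx : S x x = 2) (hx0 : 0 < ht x) : G.posRootVec ht B x ∈ G.part x :=
  (isPosSystemUpTo_posRootVec hB hht (ht x).toNat).mem hx hx0 (by omega)

theorem posRootVec_ne_zero (hB : ∀ x y, B x y + B y x = S x y)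
    (hht : ∀ x, S x x = 2 → ht x ≠ 0) (hx : S x x = 2) (hx0 : 0 < ht x) :
    G.posRootVec ht B x ≠ 0 :=
  (isPosSystemUpTo_posRootVec hB hht (ht x).toNat).ne_zero hx hx0 (by omega)

theorem lie_posRootVec (hB : ∀ x y, B x y + B y x = S x y) (hht : ∀ x, S x x = 2 → ht x ≠ 0)
    (hx : S x x = 2) (hy : S y y = 2) (h : S x y = -1) (hx0 : 0 < ht x) (hy0 : 0 < ht y) :
    ⁅G.posRootVec ht B x, G.posRootVec ht B y⁆ =
      (-1 : K) ^ B x y • G.posRootVec ht B (x + y) :=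
  lie_eq_of_prescribedVec_eq <|
    (isPosSystemUpTo_posRootVec hB hht (ht (x + y)).toNat).prescribedVec_eq
      ⟨hx, hy, hx0, hy0, h, rfl⟩ (by omega)

end PositiveRoots
end SimplyLacedGrading

namespace SimplyLacedGrading

variable {K L Λ : Type*} [Field K] [LieRing L] [LieAlgebra K L] [AddCommGroup Λ]
  {S : LinearMap.BilinForm ℤ Λ} {G : SimplyLacedGrading K L S} {x y : Λ}

variable (G) in
/-- A choice of root vectors `e x` for the roots `x`, normalized by `⁅e x, e (-x)⁆ = -coroot x`. -/
structure IsRootVectorSystem (e : Λ → L) : Prop where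
  mem : ∀ {x}, S x x = 2 → e x ∈ G.part x
  lie_neg : ∀ {x}, S x x = 2 → ⁅e x, e (-x)⁆ = -G.coroot x

namespace IsRootVectorSystem

variable [CharZero K] {e : Λ → L} (he : G.IsRootVectorSystem e) {x y z : Λ}

include he

theorem ne_zero (hx : S x x = 2) : e x ≠ 0 := by
  intro h
  have := he.lie_neg hx
  rw [h, zero_lie, eq_comm, neg_eq_zero] at this
  exact G.coroot_ne_zero hx this

theorem exists_lie_eq (h : IsRootTriple S x y z) : ∃ c : K, ⁅e x, e y⁆ = c • e (-z) := by
  have hz := G.add_self_eq_two h.left h.right h.form_eq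
  rw [← h.add_eq]
  exact G.exists_eq_smul hz (he.mem hz) (he.ne_zero hz) (G.lie_mem (he.mem h.left) (he.mem h.right))

/-- In the Jacobi identity for `e x`, `e y`, `e z`, the three double brackets are multiples of the
coroots of `x`, `y`, `z`, whose only linear relation is that their sum is zero. -/
theorem lie_rotate (h : IsRootTriple S x y z) {a : K} (ha : ⁅e x, e y⁆ = a • e (-z)) :
    ⁅e y, e z⁆ = a • e (-x) := by
  have h' := h.rotate G.toIsRootLatticeForm
  have h'' := h'.rotate G.toIsRootLatticeForm
  obtain ⟨b, hb⟩ := he.exists_lie_eq h'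
  obtain ⟨c, hc⟩ := he.exists_lie_eq h''
  have lie_neg' : ∀ {x}, S x x = 2 → ⁅e (-x), e x⁆ = G.coroot x := fun hx ↦ by
    rw [← lie_skew, he.lie_neg hx, neg_neg]
  have hJacobi := lie_lie (e x) (e y) (e z)
  rw [← lie_skew (e y) ⁅e x, e z⁆, ← lie_skew (e x) (e z), ha, hb, hc, neg_lie, smul_lie, smul_lie,
    lie_smul, lie_neg' h''.left, lie_neg' h'.left, he.lie_neg h.left,
    ← neg_eq_iff_eq_neg.2 h.add_eq, map_neg, map_add] at hJacobi
  have hx := congrArg (fun v ↦ ⁅v, e x⁆) hJacobi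
  have hy := congrArg (fun v ↦ ⁅v, e y⁆) hJacobi
  have hyx := G.comm y x ▸ h.form_eq
  simp only [smul_lie, neg_lie, sub_lie, add_lie, G.coroot_lie _ (he.mem h.left),
    G.coroot_lie _ (he.mem h.right), h.left, h.right, h.form_eq, hyx, smul_smul, ← add_smul,
    ← neg_smul, ← sub_smul] at hx hy
  have hx := smul_left_injective K (he.ne_zero h.left) hx
  have hy := smul_left_injective K (he.ne_zero h.right) hy
  push_cast at hx hy
  have : (3 : K) * (b - a) = 0 := by linear_combination 2 * hx + hy
  rw [hb, sub_eq_zero.1 ((mul_eq_zero.1 this).resolve_left (by norm_num))]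

theorem mul_eq_one_of_lie_neg_neg (h : IsRootTriple S x y z) {a b : K}
    (ha : ⁅e x, e y⁆ = a • e (-z)) (hb : ⁅e (-x), e (-y)⁆ = b • e z) : a * b = 1 := by
  have hneg : ⁅e (-y), e (-x)⁆ = (-b) • e (-(-z)) := by
    rw [← lie_skew, hb, neg_smul, neg_neg]
  have hrot := he.lie_rotate (h.neg.swap G.toIsRootLatticeForm) hneg
  rw [neg_neg] at hrot
  have hzero : ⁅e (-x), e y⁆ = 0 := G.lie_eq_zero h.neg.left h.right (by simp [h.form_eq])
    (he.mem h.neg.left) (he.mem h.right)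
  have hlie : ⁅e (-x), e x⁆ = G.coroot x := by simpa using he.lie_neg h.neg.left
  have hJacobi := leibniz_lie (e (-x)) (e x) (e y)
  rw [ha, hzero, lie_zero, add_zero, lie_smul, hrot, hlie, G.coroot_lie x (he.mem h.right),
    h.form_eq, smul_smul] at hJacobi
  have := smul_left_injective K (he.ne_zero h.right) hJacobi
  push_cast at this
  linear_combination -this

end IsRootVectorSystem

theorem exists_isRootVectorSystem_of_pos {ht : Λ →ₗ[ℤ] ℤ} (hht : ∀ x, S x x = 2 → ht x ≠ 0)
    {e : Λ → L} (hmem : ∀ {x}, S x x = 2 → 0 < ht x → e x ∈ G.part x)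
    (hne : ∀ {x}, S x x = 2 → 0 < ht x → e x ≠ 0) :
    ∃ e', G.IsRootVectorSystem e' ∧ ∀ x, 0 < ht x → e' x = e x := by
  classical
  have hdual (x : Λ) : ∃ v : L, S x x = 2 → 0 < ht x → v ∈ G.part (-x) ∧
      ⁅e x, v⁆ = -G.coroot x := by
    by_cases h : S x x = 2 ∧ 0 < ht x
    · obtain ⟨v, hv, hlie⟩ := G.exists_lie_eq_coroot_of_mem h.1 (hmem h.1 h.2) (hne h.1 h.2)
      exact ⟨-v, fun _ _ ↦ ⟨neg_mem hv, by rw [lie_neg, hlie]⟩⟩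
    · exact ⟨0, fun h1 h2 ↦ absurd ⟨h1, h2⟩ h⟩
  choose d hd using hdual
  let e' : Λ → L := fun x ↦ if 0 < ht x then e x else d (-x)
  have e'_of_pos {x} (h : 0 < ht x) : e' x = e x := if_pos h
  have e'_neg {x} (h : 0 < ht x) : e' (-x) = d x := by
    simp only [e', map_neg, neg_neg]
    exact if_neg (by omega)
  have root_cases {p : Λ → Prop} (pos : ∀ {x}, S x x = 2 → 0 < ht x → p x)
      (neg : ∀ {x}, S x x = 2 → 0 < ht x → p (-x)) {x} (hx : S x x = 2) : p x := by
    rcases (hht x hx).lt_or_gt with h | h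
    · simpa using neg (x := -x) (by simpa using hx) (by simpa using h)
    · exact pos hx h
  refine ⟨e', ⟨root_cases (p := fun x ↦ e' x ∈ G.part x) (fun hx h ↦ ?_) fun hx h ↦ ?_,
    root_cases (p := fun x ↦ ⁅e' x, e' (-x)⁆ = -G.coroot x)
    (fun hx h ↦ ?_) fun hx h ↦ ?_⟩,
    fun x ↦ e'_of_pos⟩
  · exact e'_of_pos h ▸ hmem hx h
  · exact e'_neg h ▸ (hd _ hx h).1
  · rw [e'_of_pos h, e'_neg h, (hd _ hx h).2]
  · rw [neg_neg, e'_of_pos h, e'_neg h, ← lie_skew, (hd _ hx h).2, map_neg]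

variable (G) in
/-- A root vector system with structure constants `N x y`. -/
structure IsChevalleySystem (e : Λ → L) (N : Λ → Λ → K) : Prop extends G.IsRootVectorSystem e where
  lie_eq : ∀ {x y z}, IsRootTriple S x y z → ⁅e x, e y⁆ = N x y • e (-z)

variable (G) in
theorem exists_isChevalleySystem [CharZero K] {B : LinearMap.BilinForm ℤ Λ}
    (hB : ∀ x y, B x y + B y x = S x y) {ht : Λ →ₗ[ℤ] ℤ} (hht : ∀ x, S x x = 2 → ht x ≠ 0) :
    ∃ e, G.IsChevalleySystem e fun x y ↦ (-1) ^ B x y := by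
  obtain ⟨e, he, he_pos⟩ := G.exists_isRootVectorSystem_of_pos hht (posRootVec_mem hB hht)
    (posRootVec_ne_zero hB hht)
  have pos {x y z} (h : IsRootTriple S x y z) (hx : 0 < ht x) (hy : 0 < ht y) :
      ⁅e x, e y⁆ = (-1 : K) ^ B x y • e (-z) := by
    rw [← h.add_eq, he_pos x hx, he_pos y hy, he_pos (x + y) (by rw [map_add]; omega),
      lie_posRootVec hB hht h.left h.right h.form_eq hx hy]
  have neg {x y z} (h : IsRootTriple S x y z) (hx : ht x < 0) (hy : ht y < 0) :
      ⁅e x, e y⁆ = (-1 : K) ^ B x y • e (-z) := by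
    obtain ⟨c, hc⟩ := he.exists_lie_eq h
    have hneg := pos h.neg (by simpa using hx) (by simpa using hy)
    rw [neg_neg] at hneg
    have hmul := he.mul_eq_one_of_lie_neg_neg h hc hneg
    simp only [map_neg, LinearMap.neg_apply, neg_neg] at hmul
    rw [hc, left_inv_eq_right_inv hmul (neg_one_zpow_mul_self _)]
  refine ⟨e, he, IsRootTriple.of_rotate G.toIsRootLatticeForm hht (fun h hxy ↦ ?_) pos neg⟩
  rw [he.lie_rotate h hxy, h.apply_rotate hB]

theorem IsChevalleySystem.smul {e : Λ → L} {N : Λ → Λ → K} (he : G.IsChevalleySystem e N)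
    {c : Λ → K} (hc : ∀ x, c x * c (-x) = 1) :
    G.IsChevalleySystem (fun x ↦ c x • e x) fun x y ↦ c x * c y * c (-(x + y)) * N x y where
  mem hx := Submodule.smul_mem _ _ (he.mem hx)
  lie_neg {x} hx := by rw [smul_lie, lie_smul, smul_smul, hc, one_smul, he.lie_neg hx]
  lie_eq {x y z} h := by
    simp only [smul_lie, lie_smul, smul_smul, he.lie_eq h, h.add_eq, neg_neg]
    congr 1
    linear_combination (-(c x * c y * N x y)) * hc z

end SimplyLacedGrading

theorem exists_linearMap_comp_eq_of_ker_le {K V W U : Type*} [DivisionRing K] [AddCommGroup V]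
    [Module K V] [AddCommGroup W] [Module K W] [AddCommGroup U] [Module K U] (f : V →ₗ[K] W)
    (g : V →ₗ[K] U) (h : LinearMap.ker f ≤ LinearMap.ker g) : ∃ k : W →ₗ[K] U, k ∘ₗ f = g := by
  obtain ⟨s, hs⟩ := f.rangeRestrict.exists_rightInverse_of_surjective f.range_rangeRestrict
  obtain ⟨k, hk⟩ := LinearMap.exists_extend (g ∘ₗ s)
  refine ⟨k, LinearMap.ext fun v ↦ ?_⟩
  have hkf : k (f v) = g (s (f.rangeRestrict v)) := LinearMap.congr_fun hk (f.rangeRestrict v)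
  have hsf : f (s (f.rangeRestrict v)) = f v :=
    congrArg Subtype.val (LinearMap.congr_fun hs (f.rangeRestrict v))
  rw [LinearMap.comp_apply, hkf, ← sub_eq_zero, ← map_sub]
  exact h (by rw [LinearMap.mem_ker, map_sub, hsf, sub_self])

theorem exists_linearMap_eq_on_of_iSupIndep {ι K V U : Type*} [Ring K] [AddCommGroup V]
    [Module K V] [AddCommGroup U] [Module K U] {p : ι → Submodule K V} (hp : iSupIndep p)
    (htop : ⨆ i, p i = ⊤) (T : ι → V →ₗ[K] U) :
    ∃ f : V →ₗ[K] U, ∀ i, ∀ v ∈ p i, f v = T i v := by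
  classical
  let E := LinearEquiv.ofBijective (DirectSum.coeLinearMap p)
    (DirectSum.isInternal_submodule_of_iSupIndep_of_iSup_eq_top hp htop)
  refine ⟨(DirectSum.toModule K ι U fun i ↦ T i ∘ₗ (p i).subtype) ∘ₗ E.symm.toLinearMap,
    fun i v hv ↦ ?_⟩
  have hE : E.symm v = DirectSum.lof K ι (fun i ↦ p i) i ⟨v, hv⟩ := by
    rw [LinearEquiv.symm_apply_eq]
    exact (DirectSum.coeLinearMap_lof p i ⟨v, hv⟩).symm
  simp [hE]

namespace SimplyLacedGrading

section Isomorphism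

variable {K L L' Λ Λ' : Type*} [Field K] [LieRing L] [LieAlgebra K L] [LieRing L']
  [LieAlgebra K L'] [AddCommGroup Λ] [AddCommGroup Λ'] {S : LinearMap.BilinForm ℤ Λ}
  {S' : LinearMap.BilinForm ℤ Λ'} {G : SimplyLacedGrading K L S} {G' : SimplyLacedGrading K L' S'}
  {e : Λ → L} {e' : Λ' → L'}

theorem lie_linearCombination_coroot (a : Λ →₀ K) {y : Λ} {v : L} (hv : v ∈ G.part y) :
    ⁅Finsupp.linearCombination K G.coroot a, v⁆ =
      Finsupp.linearCombination K (fun x ↦ (S x y : K)) a • v := by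
  induction a using Finsupp.induction_linear with
  | zero => simp
  | add a b ha hb => simp only [map_add, add_lie, ha, hb, add_smul]
  | single x c => simp [G.coroot_lie x hv, smul_smul]

theorem eq_zero_of_forall_lie_part_eq_zero {u : L} (h : ∀ x, ∀ v ∈ G.part x, ⁅u, v⁆ = 0) :
    u = 0 := by
  have hu : u ∈ LieAlgebra.center K L := by
    refine (LieModule.mem_maxTrivSubmodule _ _ _ _).2 fun v ↦ ?_
    have hv : v ∈ ⨆ x, G.part x := G.iSup_part ▸ Submodule.mem_top
    rw [← lie_skew, neg_eq_zero]
    induction hv using Submodule.iSup_induction' with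
    | mem x v hv => exact h x v hv
    | zero => exact lie_zero u
    | add v v' _ _ hv hv' => rw [lie_add, hv, hv', add_zero]
  rwa [G.center_eq_bot, LieSubmodule.mem_bot] at hu

theorem linearCombination_coroot_eq_zero_iff (a : Λ →₀ K) :
    Finsupp.linearCombination K G.coroot a = 0 ↔
      ∀ y, S y y = 2 → Finsupp.linearCombination K (fun x ↦ (S x y : K)) a = 0 := by
  constructor
  · intro h y hy
    obtain ⟨v, hv, hv0⟩ := G.exists_mem_part_ne_zero hy
    have hlie := lie_linearCombination_coroot a hv
    rw [h, zero_lie] at hlie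
    exact (smul_eq_zero.1 hlie.symm).resolve_right hv0
  · refine fun h ↦ G.eq_zero_of_forall_lie_part_eq_zero fun y v hv ↦ ?_
    rw [lie_linearCombination_coroot a hv]
    obtain rfl | hy0 := eq_or_ne y 0
    · simp [Finsupp.linearCombination_apply]
    by_cases hy : S y y = 2
    · rw [h y hy, zero_smul]
    · rw [G.part_eq_bot hy0 hy, Submodule.mem_bot] at hv
      rw [hv, smul_zero]

theorem coroot_injective [CharZero K] : Function.Injective G.coroot := by
  refine (injective_iff_map_eq_zero _).2 fun x hx ↦ by_contra fun hx0 ↦ (G.pos x hx0).ne' ?_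
  have h (y : Λ) (hy : S y y = 2) : S x y = 0 := by
    simpa using (linearCombination_coroot_eq_zero_iff (G := G) (.single x 1)).1 (by simp [hx]) y hy
  exact LinearMap.congr_fun (LinearMap.ext_on G.span_eq_top (f := S x) (g := 0) h) x

theorem IsRootVectorSystem.span_eq_top [CharZero K] (he : G.IsRootVectorSystem e) :
    Submodule.span K (Set.range G.coroot ∪ e '' {x | S x x = 2}) = ⊤ := by
  rw [eq_top_iff, ← G.iSup_part, iSup_le_iff]
  intro x
  obtain rfl | hx0 := eq_or_ne x 0
  · rw [G.part_zero]
    exact Submodule.span_mono Set.subset_union_left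
  by_cases hx : S x x = 2
  · intro v hv
    obtain ⟨c, rfl⟩ := G.exists_eq_smul hx (he.mem hx) (he.ne_zero hx) hv
    exact Submodule.smul_mem _ _ (Submodule.subset_span (Or.inr ⟨x, hx, rfl⟩))
  · rw [G.part_eq_bot hx0 hx]
    exact bot_le

variable {w : Λ ≃ₗ[ℤ] Λ'} (hw : ∀ x y, S' (w x) (w y) = S x y)

include hw

variable (G G') in
theorem exists_linearMap_coroot :
    ∃ f : L →ₗ[K] L', ∀ x, f (G.coroot x) = G'.coroot (w x) := by
  obtain ⟨f, hf⟩ := exists_linearMap_comp_eq_of_ker_le (Finsupp.linearCombination K G.coroot)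
    (Finsupp.linearCombination K fun x ↦ G'.coroot (w x)) fun a ha ↦ by
      rw [LinearMap.mem_ker, linearCombination_coroot_eq_zero_iff] at ha
      have hmap := Finsupp.linearCombination_mapDomain K (v' := G'.coroot) w a
      rw [LinearMap.mem_ker, ← Function.comp_def, ← hmap, linearCombination_coroot_eq_zero_iff]
      refine fun y hy ↦ ?_
      obtain ⟨y, rfl⟩ := w.surjective y
      rw [Finsupp.linearCombination_mapDomain]
      simpa only [Function.comp_def, hw] using ha y (by rwa [← hw])
  exact ⟨f, fun x ↦ by simpa using LinearMap.congr_fun hf (.single x 1)⟩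

variable (G') in
theorem IsRootVectorSystem.exists_linearMap [CharZero K] (he : G.IsRootVectorSystem e)
    (e' : Λ' → L') :
    ∃ f : L →ₗ[K] L', (∀ x, f (G.coroot x) = G'.coroot (w x)) ∧
      ∀ x, S x x = 2 → f (e x) = e' (w x) := by
  classical
  obtain ⟨f₀, hf₀⟩ := exists_linearMap_coroot G G' hw
  have hroot (x : Λ) : ∃ f : L →ₗ[K] L', S x x = 2 → f (e x) = e' (w x) := by
    by_cases hx : S x x = 2
    · obtain ⟨f, -, hf⟩ := LinearMap.exists_extend_of_notMem (p := ⊥) 0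
        (mt (Submodule.mem_bot K).1 (he.ne_zero hx)) (e' (w x))
      exact ⟨f, fun _ ↦ hf⟩
    · exact ⟨0, fun h ↦ absurd h hx⟩
  choose f' hf' using hroot
  obtain ⟨f, hf⟩ := exists_linearMap_eq_on_of_iSupIndep G.iSupIndep_part G.iSup_part
    fun x ↦ if x = 0 then f₀ else f' x
  refine ⟨f, fun x ↦ ?_, fun x hx ↦ ?_⟩
  · rw [hf 0 _ (G.coroot_mem x), if_pos rfl, hf₀]
  · rw [hf x _ (he.mem hx), if_neg (by rintro rfl; simp at hx), hf' x hx]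

variable {N : Λ → Λ → K} {N' : Λ' → Λ' → K} (he : G.IsChevalleySystem e N)
  (he' : G'.IsChevalleySystem e' N')
  (hN : ∀ x y z, IsRootTriple S x y z → N' (w x) (w y) = N x y)

include he he' hN

theorem IsChevalleySystem.map_lie_rootVector {f : L →ₗ[K] L'}
    (hf : ∀ x, f (G.coroot x) = G'.coroot (w x)) (hfe : ∀ x, S x x = 2 → f (e x) = e' (w x))
    {x y : Λ} (hx : S x x = 2) (hy : S y y = 2) : f ⁅e x, e y⁆ = ⁅f (e x), f (e y)⁆ := by
  have hwx : S' (w x) (w x) = 2 := by rw [hw, hx]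
  have hwy : S' (w y) (w y) = 2 := by rw [hw, hy]
  rw [hfe x hx, hfe y hy]
  rcases G.eq_neg_or_form_eq_neg_one_or_nonneg hx hy with rfl | h | h
  · rw [he.lie_neg hx, map_neg, hf, map_neg w, he'.lie_neg hwx]
  · have hz : S (x + y) (x + y) = 2 := G.add_self_eq_two hx hy h
    have triple : IsRootTriple S x y (-(x + y)) := ⟨hx, hy, h, (neg_neg _).symm⟩
    have triple' : IsRootTriple S' (w x) (w y) (-(w x + w y)) :=
      ⟨hwx, hwy, by rw [hw, h], (neg_neg _).symm⟩
    rw [he.lie_eq triple, he'.lie_eq triple', neg_neg, neg_neg, map_smul, hfe _ hz, hN x y _ triple,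
      map_add]
  · rw [G.lie_eq_zero hx hy h (he.mem hx) (he.mem hy), map_zero,
      G'.lie_eq_zero hwx hwy (by rwa [hw]) (he'.mem hwx) (he'.mem hwy)]

theorem IsChevalleySystem.map_lie [CharZero K] {f : L →ₗ[K] L'}
    (hf : ∀ x, f (G.coroot x) = G'.coroot (w x)) (hfe : ∀ x, S x x = 2 → f (e x) = e' (w x))
    (u v : L) : f ⁅u, v⁆ = ⁅f u, f v⁆ := by
  have coroot_root (x y : Λ) (hy : S y y = 2) :
      f ⁅G.coroot x, e y⁆ = ⁅f (G.coroot x), f (e y)⁆ := by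
    rw [G.coroot_lie x (he.mem hy), map_smul, hf, hfe y hy,
      G'.coroot_lie _ (he'.mem (by rw [hw, hy])), hw]
  have hu := he.span_eq_top ▸ Submodule.mem_top (x := u)
  have hv := he.span_eq_top ▸ Submodule.mem_top (x := v)
  induction hu, hv using Submodule.span_induction₂ with
  | mem_mem u v hu hv =>
    rcases hu with ⟨x, rfl⟩ | ⟨x, hx, rfl⟩ <;> rcases hv with ⟨y, rfl⟩ | ⟨y, hy, rfl⟩
    · rw [G.coroot_lie_coroot, hf, hf, G'.coroot_lie_coroot, map_zero]
    · exact coroot_root x y hy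
    · rw [← lie_skew, map_neg, coroot_root y x hx, lie_skew]
    · exact map_lie_rootVector hw he he' hN hf hfe hx hy
  | zero_left => simp
  | zero_right => simp
  | add_left _ _ _ _ _ _ hu hv => simp [hu, hv]
  | add_right _ _ _ _ _ _ hu hv => simp [hu, hv]
  | smul_left _ _ _ _ _ h => simp [h]
  | smul_right _ _ _ _ _ h => simp [h]

theorem IsChevalleySystem.exists_lieEquiv [CharZero K] :
    ∃ σ : L ≃ₗ⁅K⁆ L', (∀ x, σ (G.coroot x) = G'.coroot (w x)) ∧
      ∀ x, S x x = 2 → σ (e x) = e' (w x) := by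
  have hw_symm (x y : Λ') : S (w.symm x) (w.symm y) = S' x y := by
    rw [← hw, w.apply_symm_apply, w.apply_symm_apply]
  obtain ⟨f, hf, hfe⟩ := he.toIsRootVectorSystem.exists_linearMap G' hw e'
  obtain ⟨g, hg, hge⟩ := he'.toIsRootVectorSystem.exists_linearMap G hw_symm e
  have hfg : f ∘ₗ g = LinearMap.id := by
    refine LinearMap.ext_on he'.span_eq_top ?_
    rintro _ (⟨x, rfl⟩ | ⟨x, hx, rfl⟩)
    · simp [hg, hf]
    · simp [hge x hx, hfe (w.symm x) ((hw_symm x x).trans hx)]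
  have hgf : g ∘ₗ f = LinearMap.id := by
    refine LinearMap.ext_on he.span_eq_top ?_
    rintro _ (⟨x, rfl⟩ | ⟨x, hx, rfl⟩)
    · simp [hg, hf]
    · simp [hfe x hx, hge (w x) ((hw x x).trans hx)]
  let σ : L ≃ₗ⁅K⁆ L' :=
    { f with
      map_lie' := map_lie hw he he' hN hf hfe _ _
      invFun := g
      left_inv := LinearMap.congr_fun hgf
      right_inv := LinearMap.congr_fun hfg }
  exact ⟨σ, hf, hfe⟩

end Isomorphism

section Order

variable {K L Λ : Type*} [Field K] [LieRing L] [LieAlgebra K L] [AddCommGroup Λ]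
  {S : LinearMap.BilinForm ℤ Λ} {G : SimplyLacedGrading K L S} {e : Λ → L}
  {w : Λ ≃ₗ[ℤ] Λ} {B C : LinearMap.BilinForm ℤ Λ}

theorem pow_apply_coroot {T : L ≃ₗ[K] L} (hT : ∀ x, T (G.coroot x) = G.coroot (w x)) (n : ℕ)
    (x : Λ) : (T ^ n) (G.coroot x) = G.coroot ((w ^ n) x) := by
  induction n with
  | zero => simp
  | succ n ih => rw [pow_succ', LinearEquiv.mul_apply, ih, hT, pow_succ' w, LinearEquiv.mul_apply]

theorem pow_apply_rootVector (hw : ∀ x y, S (w x) (w y) = S x y) {T : L ≃ₗ[K] L}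
    (hT : ∀ x, S x x = 2 → T (e x) = (-1 : K) ^ C x x • e (w x)) (n : ℕ) {x : Λ}
    (hx : S x x = 2) :
    (T ^ n) (e x) =
      (-1 : K) ^ (∑ i ∈ Finset.range n, C ((w ^ i) x) ((w ^ i) x)) • e ((w ^ n) x) := by
  have hwx : S ((w ^ n) x) ((w ^ n) x) = 2 := by
    induction n with
    | zero => simpa using hx
    | succ n ih => rwa [pow_succ', LinearEquiv.mul_apply, hw]
  induction n with
  | zero => simp
  | succ n ih =>
    rw [pow_succ', LinearEquiv.mul_apply, hw] at hwx
    rw [pow_succ', LinearEquiv.mul_apply, ih hwx, map_smul, hT _ hwx, Finset.sum_range_succ,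
      neg_one_zpow_add, mul_smul, pow_succ' w, LinearEquiv.mul_apply]

variable [CharZero K]

theorem IsChevalleySystem.exists_lieEquiv_neg_one_zpow_smul
    (he : G.IsChevalleySystem e fun x y ↦ (-1) ^ B x y) (hw : ∀ x y, S (w x) (w y) = S x y)
    (hC : ∀ x y, C x y - C y x = B (w x) (w y) - B x y) :
    ∃ σ : L ≃ₗ⁅K⁆ L, (∀ x, σ (G.coroot x) = G.coroot (w x)) ∧
      ∀ x, S x x = 2 → σ (e x) = (-1 : K) ^ C x x • e (w x) := by
  have he' := he.smul (c := fun x ↦ (-1) ^ C (w.symm x) (w.symm x)) fun x ↦ by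
    simp [neg_one_zpow_mul_self]
  obtain ⟨σ, hσ, hσe⟩ := he.exists_lieEquiv hw he' fun x y _ _ ↦ by
    simp only [← neg_one_zpow_add]
    refine neg_one_zpow_eq_of_modEq (Int.modEq_iff_dvd.2 ⟨-C x x - C y y - C x y, ?_⟩)
    simp only [map_neg, map_add, LinearMap.neg_apply, LinearMap.add_apply, w.symm_apply_apply]
    linarith [hC x y]
  exact ⟨σ, hσ, fun x hx ↦ by simpa using hσe x hx⟩

variable (G) in
theorem exists_lieEquiv_orderOf_eq [Module.Free ℤ Λ] {ht : Λ →ₗ[ℤ] ℤ}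
    (hht : ∀ x, S x x = 2 → ht x ≠ 0) (hw : ∀ x y, S (w x) (w y) = S x y)
    (hell : IsEllipticAut w) :
    ∃ σ : L ≃ₗ⁅K⁆ L, (∀ x, σ (G.coroot x) = G.coroot (w x)) ∧
      orderOf (σ.toLinearEquiv : L ≃ₗ[K] L) = orderOf w := by
  have : IsAddTorsionFree Λ := .of_isTorsionFree ℤ Λ
  obtain ⟨B, hB⟩ := exists_add_flip_eq_of_even G.comm G.even_self
  have hB_self (x : Λ) : B (w x) (w x) = B x x := by linarith [hB x x, hB (w x) (w x), hw x x]
  obtain ⟨C, hC⟩ := exists_sub_flip_eq_of_alternating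
    (D := B.compl₁₂ w.toLinearMap w.toLinearMap - B) fun x ↦ sub_eq_zero.2 (hB_self x)
  replace hC : ∀ x y, C x y - C y x = B (w x) (w y) - B x y := hC
  obtain ⟨e, he⟩ := G.exists_isChevalleySystem hB hht
  obtain ⟨σ, hσ, hσe⟩ := he.exists_lieEquiv_neg_one_zpow_smul hw hC
  have pow_coroot := pow_apply_coroot (T := σ.toLinearEquiv) hσ
  refine ⟨σ, hσ, orderOf_eq_orderOf_iff.2 fun n ↦ ⟨fun h ↦ ?_, fun h ↦ ?_⟩⟩
  · exact LinearEquiv.ext fun x ↦ G.coroot_injective (by rw [← pow_coroot, h]; rfl)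
  · refine LinearEquiv.toLinearMap_injective (LinearMap.ext_on he.span_eq_top ?_)
    rintro _ (⟨x, rfl⟩ | ⟨x, hx, rfl⟩)
    · exact (pow_coroot n x).trans (by rw [h]; rfl)
    · have hsign := even_sum_orbit_of_isEllipticAut hell h hC x
      exact (pow_apply_rootVector (T := σ.toLinearEquiv) hw hσe n hx).trans
        (by rw [hsign.neg_one_zpow, one_smul, h]; rfl)

end Order
end SimplyLacedGrading

/-- The roots of a simply laced root system inside their root lattice, described through the
invariant form: a generating set of norm two vectors closed under negation and under sums of
roots at obtuse angles. -/
structure IsSimplyLacedRootSet {Λ : Type*} [AddCommGroup Λ] (S : LinearMap.BilinForm ℤ Λ)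
    (R : Set Λ) : Prop where
  comm : ∀ x y, S x y = S y x
  form_self : ∀ {a}, a ∈ R → S a a = 2
  neg_mem : ∀ {a}, a ∈ R → -a ∈ R
  add_mem : ∀ {a b}, a ∈ R → b ∈ R → S a b < 0 → a + b ≠ 0 → a + b ∈ R
  span_eq_top : Submodule.span ℤ R = ⊤

namespace IsSimplyLacedRootSet

variable {Λ : Type*} [AddCommGroup Λ] {S : LinearMap.BilinForm ℤ Λ} {R : Set Λ}

theorem exists_multiset_sum_eq (hR : IsSimplyLacedRootSet S R) (x : Λ) :
    ∃ s : Multiset Λ, (∀ a ∈ s, a ∈ R) ∧ s.sum = x := by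
  have hneg : -R = R := Set.ext fun a ↦ ⟨fun ha ↦ neg_neg a ▸ hR.neg_mem ha, hR.neg_mem⟩
  have hclosure : (AddSubgroup.closure R).toAddSubmonoid = AddSubmonoid.closure R := by
    rw [AddSubgroup.closure_toAddSubmonoid, hneg, Set.union_self]
  have hx : x ∈ AddSubgroup.closure R := by
    rw [← Submodule.span_int_eq_addSubgroupClosure, hR.span_eq_top]
    trivial
  exact AddSubmonoid.exists_multiset_of_mem_closure (hclosure ▸ hx)

theorem two_mul_card_le (hR : IsSimplyLacedRootSet S R) (s : Multiset Λ) (hs : ∀ a ∈ s, a ∈ R)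
    (hnonneg : ∀ a b t, s = a ::ₘ b ::ₘ t → 0 ≤ S a b) :
    2 * (s.card : ℤ) ≤ S s.sum s.sum := by
  induction s using Multiset.induction_on with
  | empty => simp
  | cons a s ih =>
    have hsum := ih (fun b hb ↦ hs b (Multiset.mem_cons_of_mem hb)) fun b c t h ↦
      hnonneg b c (a ::ₘ t) (by rw [h, Multiset.cons_swap a b, Multiset.cons_swap a c])
    have hcross : 0 ≤ S a s.sum := by
      rw [map_multiset_sum]
      refine Multiset.sum_nonneg fun n hn ↦ ?_
      obtain ⟨b, hb, rfl⟩ := Multiset.mem_map.1 hn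
      obtain ⟨t, rfl⟩ := Multiset.exists_cons_of_mem hb
      exact hnonneg a b t rfl
    rw [Multiset.sum_cons, form_add_self hR.comm, hR.form_self (hs a (Multiset.mem_cons_self a s)),
      Multiset.card_cons]
    push_cast
    linarith

/-- In a shortest expression of `x` as a sum of roots no two summands form an obtuse angle, since
otherwise they could be merged or cancelled. -/
theorem exists_multiset_sum_eq_and_two_mul_card_le (hR : IsSimplyLacedRootSet S R) (x : Λ) :
    ∃ s : Multiset Λ, (∀ a ∈ s, a ∈ R) ∧ s.sum = x ∧ 2 * (s.card : ℤ) ≤ S x x := by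
  obtain ⟨s, ⟨hs, rfl⟩, hmin⟩ := exists_minimalFor_of_wellFoundedLT
    (fun s : Multiset Λ ↦ (∀ a ∈ s, a ∈ R) ∧ s.sum = x) Multiset.card
    (hR.exists_multiset_sum_eq x)
  refine ⟨s, hs, rfl, hR.two_mul_card_le s hs ?_⟩
  rintro a b t rfl
  by_contra! hneg
  have ht : ∀ c ∈ t, c ∈ R := fun c hc ↦ hs c (by simp [hc])
  have hcard : ∀ s' : Multiset Λ, (∀ c ∈ s', c ∈ R) → s'.sum = a + b + t.sum →
      t.card + 2 ≤ s'.card := fun s' hs' hsum ↦ by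
    by_contra! hlt
    have := hmin (j := s') ⟨hs', by simp [hsum, add_assoc]⟩
    simp only [Multiset.card_cons] at this
    omega
  by_cases hab : a + b = 0
  · have := hcard t ht (by rw [hab, zero_add])
    omega
  · have habR := hR.add_mem (hs a (by simp)) (hs b (by simp)) hneg hab
    have := hcard ((a + b) ::ₘ t)
      (Multiset.forall_mem_cons.2 ⟨habR, ht⟩) (Multiset.sum_cons _ _)
    rw [Multiset.card_cons] at this
    omega

theorem mem_of_form_self_eq_two (hR : IsSimplyLacedRootSet S R) {x : Λ} (hx : S x x = 2) :
    x ∈ R := by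
  obtain ⟨s, hs, rfl, hcard⟩ := hR.exists_multiset_sum_eq_and_two_mul_card_le x
  have hpos : 0 < s.card := Multiset.card_pos.2 (by rintro rfl; simp at hx)
  obtain ⟨a, rfl⟩ := Multiset.card_eq_one.1 (show s.card = 1 by omega)
  simpa using hs

theorem isRootLatticeForm (hR : IsSimplyLacedRootSet S R) : IsRootLatticeForm S where
  comm := hR.comm
  pos x hx := by
    obtain ⟨s, -, rfl, hcard⟩ := hR.exists_multiset_sum_eq_and_two_mul_card_le x
    have : 0 < s.card := Multiset.card_pos.2 (by rintro rfl; simp at hx)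
    omega
  span_eq_top := top_unique (hR.span_eq_top ▸ Submodule.span_mono fun _ ↦ hR.form_self)

end IsSimplyLacedRootSet

section RootLattice

variable {ι K M N : Type*} [Field K] [CharZero K] [AddCommGroup M] [Module K M] [AddCommGroup N]
  [Module K N] {P : RootPairing ι K M N} [P.IsCrystallographic]

theorem rootLatticeForm_rootLatticeProj [Finite ι] (h : P.IsSimplyLaced) (c : ι →₀ ℤ) :
    rootLatticeForm h (P.rootLatticeProj c) = P.corootComb c := by
  have : (P.rootLatticeProj.quotKerEquivOfSurjective P.rootLatticeProj_surjective).symm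
      (P.rootLatticeProj c) = (LinearMap.ker P.rootLatticeProj).mkQ c := by
    rw [LinearEquiv.symm_apply_eq, Submodule.mkQ_apply,
      LinearMap.quotKerEquivOfSurjective_apply_mk]
  rw [rootLatticeForm, LinearMap.comp_apply, LinearEquiv.coe_coe, this, Submodule.mkQ_apply,
    Submodule.liftQ_apply]

theorem rootLatticeForm_rootSpanMem [Finite ι] (h : P.IsSimplyLaced) (i : ι) :
    rootLatticeForm h (P.rootSpanMem ℤ i) = P.coroot'In ℤ i := by
  simpa [rootLatticeProj, corootComb] using
    rootLatticeForm_rootLatticeProj h (Finsupp.single i 1)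

theorem cast_rootLatticeForm_rootSpanMem [Finite ι] (h : P.IsSimplyLaced) (i : ι)
    (x : P.rootSpan ℤ) : (rootLatticeForm h (P.rootSpanMem ℤ i) x : K) = P.coroot' i x := by
  rw [rootLatticeForm_rootSpanMem, ← P.algebraMap_coroot'In_apply ℤ, eq_intCast]

theorem rootLatticeForm_comm [Finite ι] (h : P.IsSimplyLaced) (x y : P.rootSpan ℤ) :
    rootLatticeForm h x y = rootLatticeForm h y x := by
  obtain ⟨c, rfl⟩ := P.rootLatticeProj_surjective x
  obtain ⟨d, rfl⟩ := P.rootLatticeProj_surjective y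
  rw [rootLatticeForm_rootLatticeProj, rootLatticeForm_rootLatticeProj, h.corootComb_apply_comm]

theorem isSimplyLacedRootSet_range_rootSpanMem [Finite ι] (h : P.IsSimplyLaced) :
    IsSimplyLacedRootSet (rootLatticeForm h) (Set.range (P.rootSpanMem ℤ)) where
  comm := rootLatticeForm_comm h
  form_self := by
    rintro _ ⟨i, rfl⟩
    exact rootLatticeForm_root_self h i
  neg_mem := by
    rintro _ ⟨i, rfl⟩
    exact ⟨_, P.rootSpanMem_reflectionPerm_self ℤ i⟩
  add_mem := by
    rintro _ _ ⟨i, rfl⟩ ⟨j, rfl⟩ hneg hne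
    rw [rootLatticeForm_root_root] at hneg
    obtain ⟨k, hk⟩ := P.root_add_root_mem_of_pairingIn_neg hneg fun hij ↦
      hne (Subtype.ext (by simp [hij]))
    exact ⟨k, Subtype.ext (by simp [hk])⟩
  span_eq_top := by
    rw [← Finsupp.range_linearCombination]
    exact LinearMap.range_eq_top.2 P.rootLatticeProj_surjective

theorem rootLatticeForm_self_eq_two_iff [Finite ι] (h : P.IsSimplyLaced) {x : P.rootSpan ℤ} :
    rootLatticeForm h x x = 2 ↔ ∃ i, P.rootSpanMem ℤ i = x :=
  ⟨(isSimplyLacedRootSet_range_rootSpanMem h).mem_of_form_self_eq_two,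
    (isSimplyLacedRootSet_range_rootSpanMem h).form_self⟩

theorem free_rootSpan [Finite ι] (P : RootPairing ι K M N) [P.IsCrystallographic]
    [P.IsRootSystem] [P.IsReduced] : Module.Free ℤ (P.rootSpan ℤ) :=
  let ⟨b⟩ := P.nonempty_base
  .of_basis b.toWeightBasisInt

theorem exists_dual_rootSpanMem_ne_zero [Finite ι] (P : RootPairing ι K M N)
    [P.IsCrystallographic] [P.IsRootSystem] [P.IsReduced] :
    ∃ ht : P.rootSpan ℤ →ₗ[ℤ] ℤ, ∀ i, ht (P.rootSpanMem ℤ i) ≠ 0 := by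
  obtain ⟨b⟩ := P.nonempty_base
  refine ⟨b.toWeightBasisInt.constr ℤ fun _ ↦ 1, fun i ↦ ?_⟩
  obtain ⟨f, -, -, hf⟩ := b.exists_root_eq_sum_int i
  have hsum : P.rootSpanMem ℤ i = ∑ j : b.support, f j • b.toWeightBasisInt j := by
    apply Subtype.ext
    simp only [AddSubmonoidClass.coe_finsetSum, Submodule.coe_smul,
      Base.coe_toWeightBasisInt_apply]
    rw [hf, ← Finset.sum_coe_sort]
  have hheight := b.height_ne_zero i
  rw [b.height_eq_sum hf, ← Finset.sum_coe_sort] at hheight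
  simpa only [hsum, map_sum, map_smul, Basis.constr_basis, smul_eq_mul, mul_one] using hheight

end RootLattice

section RootSpaces

variable {K L : Type*} [Field K] [CharZero K] [LieRing L] [LieAlgebra K L]
  [FiniteDimensional K L] [IsKilling K L] {H : LieSubalgebra K L} [H.IsCartanSubalgebra]
  [IsTriangularizable K H L]

theorem eq_of_forall_rootLattice_apply_eq {h h' : H}
    (hh : ∀ μ : rootLattice H, (μ : Dual K H) h = (μ : Dual K H) h') : h = h' := by
  rw [← sub_eq_zero, ← Submodule.mem_bot K, ← iInf_ker_weight_eq_bot (K := K) (L := L) (H := H),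
    Submodule.mem_iInf]
  intro α
  change Weight.toLinear K H L α (h - h') = 0
  by_cases hα : α.IsZero
  · exact congrFun hα (h - h')
  · rw [map_sub, sub_eq_zero]
    exact hh ((rootSystem H).rootSpanMem ℤ ⟨α, by simpa using hα⟩)

theorem exists_apply_eq_rootLatticeForm (hsl : (rootSystem H).IsSimplyLaced) (x : rootLattice H) :
    ∃ h : H, ∀ μ : rootLattice H, (μ : Dual K H) h = (rootLatticeForm hsl x μ : K) := by
  obtain ⟨c, rfl⟩ := (rootSystem H).rootLatticeProj_surjective x
  induction c using Finsupp.induction_linear with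
  | zero => exact ⟨0, by simp⟩
  | add c d hc hd =>
    obtain ⟨h, hh⟩ := hc
    obtain ⟨h', hh'⟩ := hd
    exact ⟨h + h', fun μ ↦ by simp [hh, hh']⟩
  | single i n =>
    refine ⟨n • (rootSystem H).coroot i, fun μ ↦ ?_⟩
    rw [rootLatticeProj, Finsupp.linearCombination_single, map_zsmul, map_zsmul,
      LinearMap.smul_apply, smul_eq_mul, Int.cast_mul, cast_rootLatticeForm_rootSpanMem,
      zsmul_eq_mul]
    rfl

/-- The additive map from the root lattice of a simply laced Lie algebra to the Cartan subalgebra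
that extends the passage from roots to coroots. It sends `x` to the element representing the
functional `(x, ·)`. -/
def corootHom (hsl : (rootSystem H).IsSimplyLaced) : rootLattice H →+ H :=
  AddMonoidHom.mk' (fun x ↦ (exists_apply_eq_rootLatticeForm hsl x).choose) fun x y ↦
    eq_of_forall_rootLattice_apply_eq fun μ ↦ by
      refine ((exists_apply_eq_rootLatticeForm hsl (x + y)).choose_spec μ).trans ?_
      rw [map_add (rootLatticeForm hsl), LinearMap.add_apply, Int.cast_add,
        map_add (μ : Dual K H), (exists_apply_eq_rootLatticeForm hsl x).choose_spec,
        (exists_apply_eq_rootLatticeForm hsl y).choose_spec]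

variable (hsl : (rootSystem H).IsSimplyLaced)

theorem apply_corootHom (x μ : rootLattice H) :
    (μ : Dual K H) (corootHom hsl x) = (rootLatticeForm hsl x μ : K) :=
  (exists_apply_eq_rootLatticeForm hsl x).choose_spec μ

theorem corootHom_rootSpanMem (i : H.root) :
    corootHom hsl ((rootSystem H).rootSpanMem ℤ i) = coroot i.1 :=
  eq_of_forall_rootLattice_apply_eq fun μ ↦ by
    rw [apply_corootHom, cast_rootLatticeForm_rootSpanMem]
    rfl

theorem span_range_corootHom : Submodule.span K (Set.range (corootHom hsl)) = ⊤ := by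
  rw [eq_top_iff, ← IsRootSystem.span_coroot_eq_top (P := rootSystem H)]
  refine Submodule.span_mono ?_
  rintro _ ⟨i, rfl⟩
  exact ⟨_, corootHom_rootSpanMem hsl i⟩

theorem span_range_coe_corootHom :
    Submodule.span K (Set.range fun x ↦ (corootHom hsl x : L)) = H.toSubmodule := by
  have := congrArg (Submodule.map H.toSubmodule.subtype) (span_range_corootHom hsl)
  rwa [Submodule.map_top, Submodule.range_subtype, Submodule.map_span, ← Set.range_comp] at this

theorem rootLattice_coe_injective :
    Function.Injective fun x : rootLattice H ↦ ((x : Dual K H) : H → K) :=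
  DFunLike.coe_injective.comp Subtype.val_injective

variable {hsl} in
theorem exists_weight_of_form_self_eq_two {x : rootLattice H} (hx : rootLatticeForm hsl x x = 2) :
    ∃ α : Weight K H L, α.IsNonZero ∧ (α : H → K) = (x : Dual K H) ∧
      corootHom hsl x = coroot α := by
  obtain ⟨⟨α, hα⟩, rfl⟩ := (rootLatticeForm_self_eq_two_iff hsl).1 hx
  exact ⟨α, by simpa using hα, rfl, corootHom_rootSpanMem hsl ⟨α, hα⟩⟩

variable {hsl} in
theorem finrank_rootSpace_of_form_self_eq_two {x : rootLattice H}
    (hx : rootLatticeForm hsl x x = 2) : finrank K (rootSpace H (x : Dual K H)) = 1 := by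
  obtain ⟨α, hα, hαx, -⟩ := exists_weight_of_form_self_eq_two hx
  rw [← hαx]
  exact finrank_rootSpace_eq_one α hα

variable {hsl} in
theorem exists_mem_rootSpace_lie_eq_corootHom {x : rootLattice H}
    (hx : rootLatticeForm hsl x x = 2) :
    ∃ u ∈ rootSpace H (x : Dual K H), ∃ v ∈ rootSpace H (-x : rootLattice H).1,
      ⁅u, v⁆ = (corootHom hsl x : L) := by
  obtain ⟨α, hα, hαx, hcoroot⟩ := exists_weight_of_form_self_eq_two hx
  obtain ⟨h, u, v, hs, hu, hv⟩ := exists_isSl2Triple_of_weight_isNonZero hα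
  refine ⟨u, hαx ▸ hu, v, ?_, by rw [hs.lie_e_f, hs.h_eq_coroot hα hu hv, hcoroot]⟩
  rwa [hαx] at hv

theorem rootSpace_eq_bot_of_form_self_ne_two {x : rootLattice H} (hx : x ≠ 0)
    (hx2 : rootLatticeForm hsl x x ≠ 2) : rootSpace H (x : Dual K H) = ⊥ := by
  by_contra h
  let α : Weight K H L := ⟨(x : Dual K H), h⟩
  have hα : α.IsNonZero := fun h0 ↦ hx (rootLattice_coe_injective h0)
  exact hx2 <| (rootLatticeForm_self_eq_two_iff hsl).2
    ⟨⟨α, by simpa using hα⟩, rootLattice_coe_injective rfl⟩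

theorem iSup_rootSpace_rootLattice :
    ⨆ x : rootLattice H, (rootSpace H (x : Dual K H)).toSubmodule = ⊤ := by
  have htop := congrArg LieSubmodule.toSubmodule (iSup_genWeightSpace_eq_top' K H L)
  rw [LieSubmodule.iSup_toSubmodule, LieSubmodule.top_toSubmodule] at htop
  rw [eq_top_iff, ← htop, iSup_le_iff]
  intro α
  obtain ⟨x, hx⟩ : ∃ x : rootLattice H, ((x : Dual K H) : H → K) = α := by
    by_cases hα : α.IsZero
    · exact ⟨0, hα.symm⟩
    · exact ⟨(rootSystem H).rootSpanMem ℤ ⟨α, by simpa using hα⟩, rfl⟩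
  rw [← hx]
  exact le_iSup (fun x : rootLattice H ↦ (rootSpace H (x : Dual K H)).toSubmodule) x

/-- The root space decomposition of a simply laced Lie algebra, as a grading by the root lattice. -/
def rootSpaceGrading : SimplyLacedGrading K L (rootLatticeForm hsl) where
  toIsRootLatticeForm := (isSimplyLacedRootSet_range_rootSpanMem hsl).isRootLatticeForm
  part x := (rootSpace H (x : Dual K H)).toSubmodule
  iSupIndep_part := (LieSubmodule.iSupIndep_toSubmodule.2 (iSupIndep_genWeightSpace K H L)).comp
    rootLattice_coe_injective
  iSup_part := iSup_rootSpace_rootLattice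
  lie_mem := lie_mem_genWeightSpace_of_mem_genWeightSpace
  coroot := H.toSubmodule.subtype.toAddMonoidHom.comp (corootHom hsl)
  part_zero := (congrArg LieSubmodule.toSubmodule (rootSpace_zero_eq K L H)).trans
    (span_range_coe_corootHom hsl).symm
  coroot_lie x y v hv := by
    rw [← apply_corootHom]
    exact lie_eq_smul_of_mem_rootSpace hv (corootHom hsl x)
  part_eq_bot hx hx2 := by
    rw [rootSpace_eq_bot_of_form_self_ne_two hsl hx hx2, LieSubmodule.bot_toSubmodule]
  finrank_part := finrank_rootSpace_of_form_self_eq_two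
  exists_lie_eq_coroot := exists_mem_rootSpace_lie_eq_corootHom
  center_eq_bot := LieAlgebra.center_eq_bot K L

variable {hsl} in
theorem isLiftOf_of_apply_corootHom {σ : L ≃ₗ⁅K⁆ L} {w : rootLattice H ≃ₗ[ℤ] rootLattice H}
    (hw : w ∈ rootLatticeAut hsl)
    (hσ : ∀ x, σ (corootHom hsl x) = (corootHom hsl (w x) : L)) : IsLiftOf H σ w := by
  have hmap : H.map (σ : L →ₗ⁅K⁆ L) = H := by
    rw [← LieSubalgebra.toSubmodule_inj]
    change H.toSubmodule.map (σ : L →ₗ[K] L) = H.toSubmodule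
    rw [← span_range_coe_corootHom hsl, Submodule.map_span, ← Set.range_comp,
      ← w.surjective.range_comp (fun x ↦ (corootHom hsl x : L))]
    exact congrArg (fun f ↦ Submodule.span K (Set.range f)) (funext hσ)
  refine ⟨hmap, fun μ x y hy ↦ ?_⟩
  have hmem (z : L) (hz : z ∈ H) : σ z ∈ H :=
    hmap ▸ (LieSubalgebra.mem_map _ _ _).2 ⟨z, hz, rfl⟩
  let σH : H →ₗ[K] H := (σ : L →ₗ[K] L).restrict hmem
  have hσH : ∀ z, σH (corootHom hsl z) = corootHom hsl (w z) := fun z ↦ Subtype.ext (hσ z)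
  have hμ : (w μ : Dual K H) ∘ₗ σH = μ :=
    LinearMap.ext_on_range (span_range_corootHom hsl) fun z ↦ by
      rw [LinearMap.comp_apply, hσH, apply_corootHom, apply_corootHom, hw z μ]
  rw [← hμ, show y = σH x from Subtype.ext hy, LinearMap.comp_apply]

end RootSpaces

theorem mainTheorem6_general {K L : Type*} [Field K] [CharZero K] [LieRing L] [LieAlgebra K L]
    [FiniteDimensional K L] [IsKilling K L] (H : LieSubalgebra K L) [H.IsCartanSubalgebra]
    [IsTriangularizable K H L] (hsl : (rootSystem H).IsSimplyLaced)
    (w : rootLattice H ≃ₗ[ℤ] rootLattice H) (hw : w ∈ rootLatticeAut hsl)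
    (hell : IsEllipticAut w) :
    ∃ σ : L ≃ₗ⁅K⁆ L, IsLiftOf H σ w ∧ orderOf (σ.toLinearEquiv : L ≃ₗ[K] L) = orderOf w := by
  have := free_rootSpan (rootSystem H)
  obtain ⟨ht, hht⟩ := exists_dual_rootSpanMem_ne_zero (rootSystem H)
  have hht_ne_zero (x : rootLattice H) (hx : rootLatticeForm hsl x x = 2) : ht x ≠ 0 := by
    obtain ⟨i, rfl⟩ := (rootLatticeForm_self_eq_two_iff hsl).1 hx
    exact hht i
  obtain ⟨σ, hσ, horder⟩ := (rootSpaceGrading hsl).exists_lieEquiv_orderOf_eq hht_ne_zero hw hell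
  exact ⟨σ, isLiftOf_of_apply_corootHom hw hσ, horder⟩

end

/-- Every elliptic automorphism `w` of the root lattice of a simple, simply laced Lie algebra over
an algebraically closed field of characteristic zero lifts to an automorphism of the Lie algebra
of the same order as `w`. -/
theorem mainTheorem6 {K L : Type*} [Field K] [IsAlgClosed K] [CharZero K]
    [LieRing L] [LieAlgebra K L] [FiniteDimensional K L] [LieAlgebra.IsSimple K L]
    (H : LieSubalgebra K L) [H.IsCartanSubalgebra]
    (hsl : (LieAlgebra.IsKilling.rootSystem H).IsSimplyLaced)
    (w : LieAlgebra.rootLattice H ≃ₗ[ℤ] LieAlgebra.rootLattice H)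
    (hw : w ∈ RootPairing.rootLatticeAut hsl) (hell : IsEllipticAut w) :
    ∃ σ : L ≃ₗ⁅K⁆ L, LieAlgebra.IsLiftOf H σ w ∧
      orderOf (σ.toLinearEquiv : L ≃ₗ[K] L) = orderOf w :=
  mainTheorem6_general H hsl w hw hell
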